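/- **Diagrams.** A *diagram* is a pair $\Gamma=(N,B)$ with $N$ a finite set and $B=(B_{ij})_{i,j\in N}$ a symmetric matrix of integers whose diagonal entries $B_{ii}$ are even. Given $r=(r_i)\in\mathbb Z_{\ge 1}^N$, the *rescaled diagram* of $(\Gamma,r)$ is $(N,\widetilde B)$, where $$\widetilde B_{ij}=\frac{B_{ij}}{r_ir_j}\quad(i\ne j),\qquad \widetilde B_{ii}=\frac{B_{ii}-1}{r_i^2}.$$ **Stokes circles.** An exponential factor is a finite sum $q=\sum_{k\in\mathbb Q_{>0}}a_kz^k$ with $a_k\in\mathbb C$; its exponents are the $k$ with $a_k\neq0$. A *Stokes circle* (at $z=\infty$) is an orbit $\langle q\rangle$ of exponential factors under $z^k\mapsto e^{2\pi i nk}z^k$, $n\in\mathbb Z$. The ramification order $\mathrm{Ram}(q)$ is the least integer $r\ge1$ such that $q$ is a polynomial in $z^{1/r}$, and $\mathrm{Slope}(q)$ is the largest exponent of $q$ (and $0$ if $q=0$). An algebraic connection $(E,\nabla)$ on the affine line $\mathbb A^1(\mathbb C)$ (a vector bundle with connection) has an *irregular class* $\Theta=\sum_I n_I I$ at $\infty$: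 if $G z^{\Lambda}e^{Q}$ is a formal fundamental matrix of horizontal sections at $\infty$, where $G$ is an invertible matrix over $\mathbb C((z^{-1/m}))$ for some $m\ge1$, $Q=\mathrm{diag}(q_1,\dots,q_n)$ with exponential factors $q_j\in\mathbb C[z^{1/m}]$, and $\Lambda$ is a constant matrix commuting with $Q$, then $n_{\langle q\rangle}=\#\{j: q_j=q\}$. **Multiplicities.** For a finite set $S=\{k_0>\dots>k_p\}$ of positive rationals in $\frac1r\mathbb Z\cap\frac1{r'}\mathbb Z$, written $k_j=m_j/r=m_j'/r'$, put $$g_{r'}(S)=\gcd(r',m_0',\dots,m_p')\quad(g_{r'}(\emptyset)=r'),$$ $$\sigma_{r,r'}(S)=m_0\bigl(r'-\gcd(r',m_0')\bigr)+\sum_{j=1}^p m_j\bigl(\gcd(r',m_0',\dots,m_{j-1}')-\gcd(r',m_0',\dots,m_j')\bigr)\quad(\sigma_{r,r'}(\emptyset)=0).$$ The loop multiplicity of $I=\langle q\rangle$, with $r=\mathrm{Ram}(q)$ and $S$ the set of exponents of $q$, is $$B_{I,I}=\sigma_{r,r}(S)-r^2+1.$$ Let $I=\langle q\rangle\neq J=\langle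 q'\rangle$, $r=\mathrm{Ram}(q)$, $r'=\mathrm{Ram}(q')$. Let $\tau_k(q)$ be $q$ with all monomials of exponent $<k$ removed, let $k$ be the least element of $\frac1{\mathrm{lcm}(r,r')}\mathbb Z_{>0}$ with $\langle\tau_k(q)\rangle=\langle\tau_k(q')\rangle$, let $S_c$ be the set of exponents of $\tau_k(q)$ (equivalently of $\tau_k(q')$), and put $q_d=q-\tau_k(q)$, $q_d'=q'-\tau_k(q')$. If $\mathrm{Slope}(q_d)\ge\mathrm{Slope}(q_d')$ (otherwise exchange $I$ and $J$), write $\mathrm{Slope}(q_d)=s_d/r$; the edge multiplicity of $I$ and $J$ is $$B_{I,J}=B_{J,I}=\sigma_{r,r'}(S_c)+s_d\,g_{r'}(S_c)-rr'.$$ **Nonabelian Hodge diagrams.** A diagram $(N,B)$ is a *nonabelian Hodge diagram* if there is an algebraic connection on the affine line, with irregular class $\Theta$ at $\infty$, and a bijection $i\mapsto I_i$ from $N$ onto the set of distinct Stokes circles of $\Theta$, such that $B_{ii}=B_{I_i,I_i}$ for all $i$ and $B_{ij}=B_{I_i,I_j}$ for all $i\neq j$. **Corollary 1.9.** Let $\Gamma=(N,B)$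 be a nonabelian Hodge diagram. Then there exists $r\in\mathbb Z_{\ge1}^N$ such that the rescaled diagram $(N,\widetilde B)$ of $(\Gamma,r)$ satisfies both of the following conditions: 1. for all pairwise distinct $i,j,k\in N$, if $\widetilde B_{ij}\le\widetilde B_{ik}\le\widetilde B_{jk}$, then $\widetilde B_{ik}=\widetilde B_{jk}$; 2. for all $i,j\in N$ with $i\ne j$, $\widetilde B_{ii}\le\widetilde B_{ij}$. -/

import Mathlib

open Polynomial

noncomputable section

namespace NonabelianHodge

/-! ### Diagrams, decorations, rescaling -/

/-- A diagram on the vertex set `N` (which is finite in all uses): a symmetric matrix with integer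
entries and even diagonal. `B i j` is the (possibly negative) number of edges between `i ≠ j`, and
`B i i / 2` is the (possibly negative) number of loops at `i`. -/
structure Diagram (N : Type*) where
  B : Matrix N N ℤ
  symm : ∀ i j, B i j = B j i
  even_diag : ∀ i, Even (B i i)

open Classical in
/-- The matrix of the rescaled diagram attached to a diagram and a decoration `r ∈ ℤ_{≥1}^N`. -/
def Diagram.rescaled {N : Type*} (Γ : Diagram N) (r : N → ℕ+) : Matrix N N ℚ := fun i j =>
  if i = j then ((Γ.B i i : ℚ) - 1) / ((r i : ℕ) : ℚ) ^ 2
  else (Γ.B i j : ℚ) / (((r i : ℕ) : ℚ) * ((r j : ℕ) : ℚ))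

/-- The ultrametric condition on the off-diagonal entries. -/
def UltrametricEdges {N : Type*} (C : Matrix N N ℚ) : Prop :=
  ∀ i j k : N, i ≠ j → i ≠ k → j ≠ k → C i j ≤ C i k → C i k ≤ C j k → C i k = C j k

/-- The inequality between loops and adjacent edges. -/
def LoopEdgeInequality {N : Type*} (C : Matrix N N ℚ) : Prop :=
  ∀ i j : N, i ≠ j → C i i ≤ C i j

/-! ### Exponential factors and Stokes circles at infinity -/

/-- An exponential factor at infinity: a Puiseux polynomial `q = ∑ a_k z ^ k`, the sum being over
finitely many rational numbers `k > 0`. It is stored as the function `k ↦ a_k`. -/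
abbrev ExpFactor := {k : ℚ // 0 < k} →₀ ℂ

/-- `q'` is obtained from `q` by analytic continuation along `n` turns around infinity, i.e. by
`z ^ k ↦ exp (2 π i n k) z ^ k`, for some `n ∈ ℤ`: they are in the same Galois orbit. -/
def GaloisConj (q q' : ExpFactor) : Prop :=
  ∃ n : ℤ, ∀ k : {k : ℚ // 0 < k},
    q' k = Complex.exp (2 * Real.pi * Complex.I * (n * ((k : ℚ) : ℂ))) * q k

theorem GaloisConj.refl (q : ExpFactor) : GaloisConj q q := ⟨0, by simp⟩

theorem GaloisConj.symm {q q' : ExpFactor} (h : GaloisConj q q') : GaloisConj q' q := by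
  obtain ⟨n, hn⟩ := h
  refine ⟨-n, fun k => ?_⟩
  rw [hn k, ← mul_assoc, ← Complex.exp_add]
  push_cast
  ring_nf
  simp

theorem GaloisConj.trans {q q' q'' : ExpFactor} (h : GaloisConj q q') (h' : GaloisConj q' q'') :
    GaloisConj q q'' := by
  obtain ⟨n, hn⟩ := h
  obtain ⟨n', hn'⟩ := h'
  refine ⟨n' + n, fun k => ?_⟩
  rw [hn' k, hn k, ← mul_assoc, ← Complex.exp_add]
  push_cast
  ring_nf

/-- The equivalence relation whose classes are the Galois orbits. -/
instance galoisSetoid : Setoid ExpFactor where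
  r := GaloisConj
  iseqv := ⟨GaloisConj.refl, GaloisConj.symm, GaloisConj.trans⟩

/-- A Stokes circle at infinity: a Galois orbit `⟨q⟩` of exponential factors. -/
abbrev StokesCircle := Quotient galoisSetoid

theorem GaloisConj.support_eq {q q' : ExpFactor} (h : GaloisConj q q') :
    q'.support = q.support := by
  obtain ⟨n, hn⟩ := h
  ext k
  simp [hn k, Complex.exp_ne_zero]

/-- The ramification order: the smallest `r ≥ 1` such that `q` is a polynomial in `z ^ (1 / r)`,
that is, the least common multiple of the denominators of the exponents. It is `1` for `q = 0`. -/
def ram (q : ExpFactor) : ℕ := q.support.lcm fun k => (k : ℚ).den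

/-- The slope: the largest exponent, and `0` for `q = 0`. -/
def slope (q : ExpFactor) : ℚ≥0 := q.support.sup fun k => ⟨(k : ℚ), k.2.le⟩

/-- The numerator of `k` when it is written with denominator `r`, i.e. the integer `m` with
`k = m / r` (used only if `r * k` is an integer and `k ≥ 0`). -/
def numer (r : ℕ) (k : ℚ) : ℕ := (k * r).num.toNat

/-- For a finite set `S` of exponents, the integer `gcd (r, m_0, …, m_p)`, where the elements of
`S` are `m_0 / r, …, m_p / r`. For empty `S` this is `r`. -/
def gcdWith (r : ℕ) (S : Finset {k : ℚ // 0 < k}) : ℕ := Nat.gcd r (S.gcd fun k => numer r k)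

/-- For a finite set `S = {k_0 > ⋯ > k_p}` of exponents, with `k_j = m_j / r = m'_j / r'`, the sum
`∑ j, m_j (gcd (r', m'_0, …, m'_{j-1}) - gcd (r', m'_0, …, m'_j))`; the term for `j = 0` is
`m_0 (r' - gcd (r', m'_0))`. -/
def levelSum (r r' : ℕ) (S : Finset {k : ℚ // 0 < k}) : ℤ :=
  ∑ k ∈ S, (numer r k : ℤ) *
    ((gcdWith r' (S.filter fun l => k < l) : ℤ) - (gcdWith r' (S.filter fun l => k ≤ l) : ℤ))

/-- The loop multiplicity `B_{I,I}` of `I = ⟨q⟩`, computed from the representative `q`. -/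
def loopMultAux (q : ExpFactor) : ℤ := levelSum (ram q) (ram q) q.support - (ram q : ℤ) ^ 2 + 1

/-- The truncation `τ_k q`: remove all the monomials of exponent `< k`. -/
def trunc (k : ℚ) (q : ExpFactor) : ExpFactor := q.filter fun l => k ≤ (l : ℚ)

/-- The smallest `k ∈ (1 / lcm (r, r')) ℤ_{>0}` such that `⟨τ_k q⟩ = ⟨τ_k q'⟩`. -/
def cutoff (q q' : ExpFactor) : ℚ :=
  (sInf {n : ℕ | 0 < n ∧
      GaloisConj (trunc ((n : ℚ) / (Nat.lcm (ram q) (ram q') : ℕ)) q)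
        (trunc ((n : ℚ) / (Nat.lcm (ram q) (ram q') : ℕ)) q')} : ℕ) /
    (Nat.lcm (ram q) (ram q') : ℕ)

/-- The common part `q_c` of `q` with respect to `q'`. -/
def commonPart (q q' : ExpFactor) : ExpFactor := trunc (cutoff q q') q

/-- The different part `q_d = q - q_c` of `q` with respect to `q'`. -/
def diffPart (q q' : ExpFactor) : ExpFactor := q - commonPart q q'

/-- The formula for the edge multiplicity of `⟨q⟩` and `⟨q'⟩`
when `slope q_d ≥ slope q'_d`, so that `slope q_d = s_d / r` is the fission exponent. -/
def edgeFormula (q q' : ExpFactor) : ℤ :=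
  levelSum (ram q) (ram q') (commonPart q q').support
    + (numer (ram q) (slope (diffPart q q') : ℚ) : ℤ) *
        (gcdWith (ram q') (commonPart q q').support : ℤ)
    - (ram q : ℤ) * (ram q' : ℤ)

/-- The edge multiplicity `B_{I,J}` of `I = ⟨q⟩ ≠ J = ⟨q'⟩`, computed from `q` and `q'`. -/
def edgeMultAux (q q' : ExpFactor) : ℤ :=
  if slope (diffPart q' q) ≤ slope (diffPart q q') then edgeFormula q q' else edgeFormula q' q

/-! The multiplicities do not depend on the representatives. -/

theorem ram_congr {q q' : ExpFactor} (h : GaloisConj q q') : ram q = ram q' := by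
  simp only [ram, h.support_eq]

theorem loopMultAux_congr {q q' : ExpFactor} (h : GaloisConj q q') :
    loopMultAux q = loopMultAux q' := by
  simp only [loopMultAux, ram_congr h, h.support_eq]

theorem GaloisConj.trunc {q q' : ExpFactor} (h : GaloisConj q q') (k : ℚ) :
    GaloisConj (trunc k q) (trunc k q') := by
  obtain ⟨n, hn⟩ := h
  refine ⟨n, fun l => ?_⟩
  by_cases hl : k ≤ (l : ℚ) <;> simp [NonabelianHodge.trunc, hl, hn l]

theorem cutoff_congr {p p' q q' : ExpFactor} (h : GaloisConj p p') (h' : GaloisConj q q') :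
    cutoff p q = cutoff p' q' := by
  have key : ∀ k : ℚ, GaloisConj (trunc k p) (trunc k q) ↔
      GaloisConj (trunc k p') (trunc k q') := fun k =>
    ⟨fun H => ((h.trunc k).symm.trans H).trans (h'.trunc k),
      fun H => ((h.trunc k).trans H).trans (h'.trunc k).symm⟩
  simp only [cutoff, ram_congr h, ram_congr h', key]

theorem commonPart_congr {p p' q q' : ExpFactor} (h : GaloisConj p p') (h' : GaloisConj q q') :
    GaloisConj (commonPart p q) (commonPart p' q') := by
  simp only [commonPart, cutoff_congr h h']
  exact h.trunc _

theorem diffPart_congr {p p' q q' : ExpFactor} (h : GaloisConj p p') (h' : GaloisConj q q') :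
    GaloisConj (diffPart p q) (diffPart p' q') := by
  simp only [diffPart, commonPart, cutoff_congr h h']
  obtain ⟨n, hn⟩ := h
  refine ⟨n, fun l => ?_⟩
  by_cases hl : cutoff p' q' ≤ (l : ℚ) <;> simp [trunc, hl, hn l]

theorem edgeFormula_congr {p p' q q' : ExpFactor} (h : GaloisConj p p') (h' : GaloisConj q q') :
    edgeFormula p q = edgeFormula p' q' := by
  simp only [edgeFormula, slope, ram_congr h, ram_congr h', (commonPart_congr h h').support_eq,
    (diffPart_congr h h').support_eq]

theorem edgeMultAux_congr {p p' q q' : ExpFactor} (h : GaloisConj p p') (h' : GaloisConj q q') :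
    edgeMultAux p q = edgeMultAux p' q' := by
  simp only [edgeMultAux, slope, edgeFormula_congr h h', edgeFormula_congr h' h,
    (diffPart_congr h h').support_eq, (diffPart_congr h' h).support_eq]

/-- The loop multiplicity `B_{I,I}` of a Stokes circle. -/
def loopMult (I : StokesCircle) : ℤ := Quotient.lift loopMultAux (fun _ _ h => loopMultAux_congr h) I

/-- The edge multiplicity `B_{I,J}` of two distinct Stokes circles. -/
def edgeMult (I J : StokesCircle) : ℤ :=
  Quotient.lift₂ edgeMultAux (fun _ _ _ _ h h' => edgeMultAux_congr h h') I J

/-! ### Irregular classes and their core diagrams -/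

/-- An irregular class at infinity `Θ = ∑ n_i I_i`: a finite multiset of Stokes circles. The
distinct Stokes circles of `Θ` are the elements of `Θ.support`. -/
abbrev IrregularClass := StokesCircle →₀ ℕ

/-- `Γ` is the core diagram `Γ_c(Θ)`, its vertices being identified with the distinct Stokes
circles of `Θ` by some bijection. -/
def IsCoreDiagram {N : Type*} (Γ : Diagram N) (Θ : IrregularClass) : Prop :=
  ∃ I : N ≃ Θ.support,
    (∀ i, Γ.B i i = loopMult (I i)) ∧ ∀ i j, i ≠ j → Γ.B i j = edgeMult (I i) (I j)

/-! ### Algebraic connections on the affine line -/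

/-- An algebraic connection on the affine line `Spec ℂ[z]`: a vector bundle, given by its module
`E` of global sections, a finitely generated projective `ℂ[z]`-module, with a connection
`s ↦ nabla s ⊗ dz`. -/
structure AlgebraicConnection where
  E : Type
  [addCommGroup : AddCommGroup E]
  [module : Module ℂ[X] E]
  [finite : Module.Finite ℂ[X] E]
  [projective : Module.Projective ℂ[X] E]
  nabla : E →+ E
  leibniz : ∀ (f : ℂ[X]) (s : E), nabla (f • s) = derivative f • s + f • nabla s

attribute [instance] AlgebraicConnection.addCommGroup AlgebraicConnection.module
  AlgebraicConnection.finite AlgebraicConnection.projective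

/-- Expansion at infinity `ℂ[z] → ℂ((t))`, `z ↦ t ^ (-m)`, where `t = z ^ (-1 / m)`. -/
def expandAtInfinity (m : ℕ) : ℂ[X] →ₐ[ℂ] LaurentSeries ℂ :=
  Polynomial.aeval (HahnSeries.single (-(m : ℤ)) (1 : ℂ))

/-- The derivation `z d/dz = -(1 / m) t d/dt` of `ℂ((t))`, where `t = z ^ (-1 / m)`. -/
def eulerDeriv (m : ℕ) (f : LaurentSeries ℂ) : LaurentSeries ℂ :=
  (-(m : ℂ)⁻¹) • (HahnSeries.single (1 : ℤ) (1 : ℂ) * LaurentSeries.derivative ℂ f)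

/-- The element of `ℂ((t))`, `t = z ^ (-1 / m)`, given by the exponential factor `q`, when `m` is
a multiple of the ramification order of `q`: the monomial `z ^ k` becomes `t ^ (-m k)`. -/
def ExpFactor.toLaurent (m : ℕ) (q : ExpFactor) : LaurentSeries ℂ :=
  q.sum fun k a => HahnSeries.single (-((m : ℚ) * (k : ℚ)).num) a

/-- `Θ` is the irregular class at infinity of the connection. In a basis of `E`, with connection
matrix `A` (so the horizontal sections satisfy `dv/dz = -A v`), there is a formal
fundamental matrix of horizontal sections `G z ^ Λ exp (Q)`, where `G` is invertible with entries
in `ℂ((t))`, `t = z ^ (-1 / m)`, `Q` is the diagonal matrix of exponential factors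
`q_1, …, q_n`, polynomials in `z ^ (1 / m)`, and `Λ` is a constant matrix commuting with `Q`.
The multiplicity in `Θ` of a Stokes circle `⟨p⟩` is the number of `j` with `q_j = p`. -/
def AlgebraicConnection.HasIrregularClass (C : AlgebraicConnection) (Θ : IrregularClass) : Prop :=
  ∃ (n : ℕ) (b : Module.Basis (Fin n) ℂ[X] C.E) (m : ℕ) (G : GL (Fin n) (LaurentSeries ℂ))
    (q : Fin n → ExpFactor) (Λ : Matrix (Fin n) (Fin n) ℂ),
    0 < m ∧
    (∀ j, ram (q j) ∣ m) ∧
    (∀ i j, Λ i j ≠ 0 → q i = q j) ∧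
    (G.1.map (eulerDeriv m)
        + G.1 * (Matrix.diagonal (fun j => eulerDeriv m ((q j).toLaurent m)) + Λ.map HahnSeries.C)
      = -((b.toMatrix fun j => C.nabla (b j)).map fun a => expandAtInfinity m (X * a)) * G.1) ∧
    ∀ p : ExpFactor, Θ (Quotient.mk galoisSetoid p) = Nat.card {j : Fin n // q j = p}

/-- A nonabelian Hodge diagram: the core diagram of the irregular class at infinity of an
algebraic connection on the affine line. -/
def Diagram.IsNonabelianHodge {N : Type*} (Γ : Diagram N) : Prop :=
  ∃ (C : AlgebraicConnection) (Θ : IrregularClass), C.HasIrregularClass Θ ∧ IsCoreDiagram Γ Θ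

end NonabelianHodge

end

/-!
If `R` is the ramification order of a set of exponents `S`, the greatest common divisor attached to
`S` and to a multiple `r'` of `R` is `r' / R`. Hence, when the decoration consists of the
ramification orders, the rescaled edge multiplicity of `⟨q⟩` and `⟨q'⟩` is `h (f) - 1` and the
rescaled loop multiplicity of `⟨q⟩` is `h (0) - 1`, where `f ≥ 0` is the fission exponent of the
two circles and `h (x)` is the mean of `max x (slope (q - σ q))` over the Galois conjugates `σ q`.
The function `h` is strictly increasing and `h (x)` only depends on the exponents larger than `x`,
so it is the same for `q` and `q'` at `x = f`; since the fission exponent is an ultrametric, both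
conditions follow.
-/

namespace NonabelianHodge

/-- An exponent of an exponential factor. -/
abbrev Exponent := {k : ℚ // 0 < k}

section Ramification

/-- The ramification order of a finite set of exponents, i.e. of any exponential factor that has
these exponents. -/
def expRam (S : Finset Exponent) : ℕ := S.lcm fun k => (k : ℚ).den

theorem den_dvd_expRam {S : Finset Exponent} {k : Exponent} (hk : k ∈ S) :
    (k : ℚ).den ∣ expRam S :=
  Finset.dvd_lcm hk

theorem expRam_pos (S : Finset Exponent) : 0 < expRam S := by
  refine Nat.pos_of_ne_zero fun h => ?_
  obtain ⟨k, -, hk⟩ := Finset.lcm_eq_zero_iff.1 h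
  exact (k : ℚ).den_nz hk

theorem expRam_dvd_expRam {S T : Finset Exponent} (h : S ⊆ T) : expRam S ∣ expRam T :=
  Finset.lcm_mono h

theorem inv_expRam_anti {S T : Finset Exponent} (h : S ⊆ T) :
    (expRam T : ℚ)⁻¹ ≤ (expRam S : ℚ)⁻¹ := by
  have hS : (0 : ℚ) < expRam S := mod_cast expRam_pos S
  gcongr
  exact Nat.le_of_dvd (expRam_pos T) (expRam_dvd_expRam h)

theorem numer_cast {r : ℕ} {k : ℚ} (hk : 0 ≤ k) (h : k.den ∣ r) : (numer r k : ℚ) = k * r := by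
  obtain ⟨c, rfl⟩ := h
  have hint : k * ((k.den * c : ℕ) : ℚ) = ((k.num * c : ℤ) : ℚ) := by
    push_cast
    rw [← mul_assoc, Rat.mul_den_eq_num]
  have hnonneg : 0 ≤ k.num * (c : ℤ) := mul_nonneg (Rat.num_nonneg.2 hk) c.cast_nonneg
  rw [numer, hint, Rat.num_intCast]
  exact_mod_cast congrArg (Int.cast (R := ℚ)) (Int.toNat_of_nonneg hnonneg)

theorem numer_mul_left {r : ℕ} {k : ℚ} (hk : 0 ≤ k) (h : k.den ∣ r) (c : ℕ) :
    numer (c * r) k = c * numer r k := by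
  have hcast : (numer (c * r) k : ℚ) = c * numer r k := by
    rw [numer_cast hk (h.mul_left c), numer_cast hk h]
    push_cast
    ring
  exact_mod_cast hcast

theorem den_dvd_of_dvd_numer {d m : ℕ} {k : ℚ} (hk : 0 ≤ k) (hdm : d * m ≠ 0)
    (hden : k.den ∣ d * m) (h : d ∣ numer (d * m) k) : k.den ∣ m := by
  obtain ⟨n, hn⟩ := h
  obtain ⟨hd, hm⟩ := mul_ne_zero_iff.1 hdm
  have hd' : (d : ℚ) ≠ 0 := mod_cast hd
  have hm' : (m : ℚ) ≠ 0 := mod_cast hm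
  have hcast := numer_cast hk hden
  rw [hn] at hcast
  push_cast at hcast
  have hkm : k = Rat.divInt n m := by
    rw [Rat.divInt_eq_div]
    push_cast
    rw [eq_div_iff hm']
    apply mul_left_cancel₀ hd'
    linarith
  exact_mod_cast hkm ▸ Rat.den_dvd n m

theorem gcdWith_mul_left {r : ℕ} {S : Finset Exponent} (h : expRam S ∣ r) (c : ℕ) :
    gcdWith (c * r) S = c * gcdWith r S := by
  have hnumer : S.gcd (fun k => numer (c * r) k) = S.gcd fun k => c * numer r k :=
    Finset.gcd_congr rfl fun k hk => numer_mul_left k.2.le ((den_dvd_expRam hk).trans h) c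
  rw [gcdWith, hnumer, Finset.gcd_mul_left, normalize_eq, Nat.gcd_mul_left, gcdWith]

theorem gcdWith_expRam (S : Finset Exponent) : gcdWith (expRam S) S = 1 := by
  set d := gcdWith (expRam S) S
  obtain ⟨m, hm⟩ : d ∣ expRam S := Nat.gcd_dvd_left _ _
  have hdm : d * m ≠ 0 := hm ▸ (expRam_pos S).ne'
  have hdvd : expRam S ∣ m := Finset.lcm_dvd fun k hk => by
    have hnumer : d ∣ numer (expRam S) k := (Nat.gcd_dvd_right _ _).trans (Finset.gcd_dvd hk)
    rw [hm] at hnumer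
    exact den_dvd_of_dvd_numer k.2.le hdm (hm ▸ den_dvd_expRam hk) hnumer
  have hm0 : 0 < m := Nat.pos_of_ne_zero (right_ne_zero_of_mul hdm)
  refine Nat.dvd_one.1 (Nat.dvd_of_mul_dvd_mul_right hm0 ?_)
  rwa [← hm, one_mul]

theorem gcdWith_cast {r : ℕ} {S : Finset Exponent} (h : expRam S ∣ r) :
    (gcdWith r S : ℚ) = r * (expRam S : ℚ)⁻¹ := by
  have hS : (expRam S : ℚ) ≠ 0 := mod_cast (expRam_pos S).ne'
  obtain ⟨c, rfl⟩ := h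
  rw [mul_comm, gcdWith_mul_left dvd_rfl, gcdWith_expRam, mul_one]
  push_cast
  rw [mul_inv_cancel_right₀ hS]

end Ramification

section LevelMean

/-- The proportion of the Galois conjugates `σ q` of an exponential factor `q` with exponents `S`
for which `q - σ q` has slope `k ∈ S`: those that fix the exponents above `k`, but not `k`. -/
def ramDrop (S : Finset Exponent) (k : Exponent) : ℚ :=
  (expRam (S.filter fun l => k < l) : ℚ)⁻¹ - (expRam (S.filter fun l => k ≤ l) : ℚ)⁻¹

/-- The mean of `max x (slope (q - σ q))` over the Galois conjugates `σ q` of an exponential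
factor `q` with exponents `S`, when `0 ≤ x`; the last term accounts for `σ q = q`. -/
def levelMean (S : Finset Exponent) (x : ℚ) : ℚ :=
  ∑ k ∈ S, max (k : ℚ) x * ramDrop S k + x * (expRam S : ℚ)⁻¹

theorem ramDrop_nonneg (S : Finset Exponent) (k : Exponent) : 0 ≤ ramDrop S k :=
  sub_nonneg.2 (inv_expRam_anti (Finset.monotone_filter_right _ fun _ _ hl => le_of_lt hl))

theorem levelMean_strictMono (S : Finset Exponent) : StrictMono (levelMean S) := by
  intro x y hxy
  have hS : (0 : ℚ) < (expRam S : ℚ)⁻¹ := inv_pos.2 (mod_cast expRam_pos S)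
  refine add_lt_add_of_le_of_lt (Finset.sum_le_sum fun k _ => ?_)
    (mul_lt_mul_of_pos_right hxy hS)
  exact mul_le_mul_of_nonneg_right (max_le_max_left _ hxy.le) (ramDrop_nonneg S k)

theorem levelMean_insert {a : Exponent} {T : Finset Exponent} (ha : ∀ k ∈ T, a < k) (x : ℚ) :
    levelMean (insert a T) x =
      levelMean T x + (max (a : ℚ) x - x) * ((expRam T : ℚ)⁻¹ - (expRam (insert a T) : ℚ)⁻¹) := by
  have haT : a ∉ T := fun h => lt_irrefl a (ha a h)
  have hdrop_of_mem : ∀ k ∈ T, ramDrop (insert a T) k = ramDrop T k := fun k hk => by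
    rw [ramDrop, ramDrop, Finset.filter_insert, Finset.filter_insert, if_neg (ha k hk).not_gt,
      if_neg (ha k hk).not_ge]
  have hdrop_self : ramDrop (insert a T) a = (expRam T : ℚ)⁻¹ - (expRam (insert a T) : ℚ)⁻¹ := by
    rw [ramDrop, Finset.filter_insert, Finset.filter_insert, if_neg (lt_irrefl a), if_pos le_rfl,
      Finset.filter_true_of_mem ha, Finset.filter_true_of_mem fun k hk => (ha k hk).le]
  rw [levelMean, levelMean, Finset.sum_insert haT, hdrop_self,
    Finset.sum_congr rfl fun k hk => congrArg _ (hdrop_of_mem k hk)]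
  ring

theorem levelMean_filter_lt (S : Finset Exponent) (x : ℚ) :
    levelMean (S.filter fun k : Exponent => x < (k : ℚ)) x = levelMean S x := by
  induction S using Finset.induction_on_min with
  | empty => rfl
  | insert a T ha ih =>
    rcases lt_or_ge x (a : ℚ) with hxa | hax
    · rw [Finset.filter_true_of_mem]
      intro k hk
      rcases Finset.mem_insert.1 hk with rfl | hk
      · exact hxa
      · exact hxa.trans (ha k hk)
    · rw [Finset.filter_insert, if_neg hax.not_gt, ih, levelMean_insert ha, max_eq_right hax,
        sub_self, zero_mul, add_zero]

theorem levelMean_of_lt {S : Finset Exponent} {x : ℚ} (h : ∀ k ∈ S, x < (k : ℚ)) :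
    levelMean S x = ∑ k ∈ S, (k : ℚ) * ramDrop S k + x * (expRam S : ℚ)⁻¹ := by
  rw [levelMean, Finset.sum_congr rfl fun k hk => congrArg (· * _) (max_eq_left (h k hk).le)]

theorem levelSum_cast {r r' : ℕ} {S : Finset Exponent} (h : expRam S ∣ r) (h' : expRam S ∣ r') :
    (levelSum r r' S : ℚ) = r * r' * ∑ k ∈ S, (k : ℚ) * ramDrop S k := by
  rw [levelSum, Finset.mul_sum]
  push_cast
  refine Finset.sum_congr rfl fun k hk => ?_
  have hgcd (p : Exponent → Prop) [DecidablePred p] :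
      (gcdWith r' (S.filter p) : ℚ) = r' * (expRam (S.filter p) : ℚ)⁻¹ :=
    gcdWith_cast ((expRam_dvd_expRam (Finset.filter_subset _ _)).trans h')
  rw [numer_cast k.2.le ((den_dvd_expRam hk).trans h), hgcd, hgcd, ramDrop]
  ring

end LevelMean

section Cutoff

variable (q q' : ExpFactor)

theorem ram_pos : 0 < ram q := expRam_pos _

theorem ram_filter_dvd (p : Exponent → Prop) [DecidablePred p] : ram (q.filter p) ∣ ram q :=
  expRam_dvd_expRam (Finset.filter_subset _ _)

theorem den_slope_dvd_ram : (slope q : ℚ).den ∣ ram q := by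
  refine Finset.sup_induction (p := fun s : ℚ≥0 => (s : ℚ).den ∣ ram q) (one_dvd _)
    (fun s hs t ht => ?_) fun k hk => den_dvd_expRam hk
  rcases max_choice s t with h | h <;> rwa [h]

variable {q q'}

theorem le_slope {k : Exponent} (hk : k ∈ q.support) : (k : ℚ) ≤ slope q :=
  NNRat.coe_le_coe.2 (Finset.le_sup (f := fun k : Exponent => (⟨(k : ℚ), k.2.le⟩ : ℚ≥0)) hk)

theorem slope_lt {x : ℚ} (hx : 0 < x) (h : ∀ k ∈ q.support, (k : ℚ) < x) : (slope q : ℚ) < x :=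
  NNRat.coe_lt_coe (q := ⟨x, hx.le⟩).2 ((Finset.sup_lt_iff hx).2 h)

theorem trunc_eq_zero {x : ℚ} (h : (slope q : ℚ) < x) : trunc x q = 0 := by
  refine (Finsupp.filter_eq_zero_iff _ _).2 fun k hxk => ?_
  by_contra hqk
  exact ((le_slope (Finsupp.mem_support_iff.2 hqk)).trans_lt h).not_ge hxk

theorem GaloisConj.filter (h : GaloisConj q q') (p : Exponent → Prop) [DecidablePred p] :
    GaloisConj (q.filter p) (q'.filter p) := by
  obtain ⟨n, hn⟩ := h
  refine ⟨n, fun k => ?_⟩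
  by_cases hk : p k <;> simp [hk, hn k]

theorem GaloisConj.filter_of_imp {p₁ p₂ : Exponent → Prop} [DecidablePred p₁] [DecidablePred p₂]
    (h : GaloisConj (q.filter p₁) (q'.filter p₁)) (hp : ∀ k, p₂ k → p₁ k) :
    GaloisConj (q.filter p₂) (q'.filter p₂) := by
  have hfilter (f : ExpFactor) : (f.filter p₁).filter p₂ = f.filter p₂ := by
    ext k
    by_cases hk : p₂ k <;> simp [hk, hp]
  simpa only [hfilter] using h.filter p₂

variable (q q')

theorem lcm_ram_pos : 0 < Nat.lcm (ram q) (ram q') := Nat.lcm_pos (ram_pos q) (ram_pos q')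

theorem cutoff_spec :
    0 < cutoff q q' ∧ GaloisConj (trunc (cutoff q q') q) (trunc (cutoff q q') q') := by
  have hL : (0 : ℚ) < Nat.lcm (ram q) (ram q') := mod_cast lcm_ram_pos q q'
  obtain ⟨n, hn⟩ := exists_nat_gt (max (slope q : ℚ) (slope q') * Nat.lcm (ram q) (ram q'))
  have hslope : max (slope q : ℚ) (slope q') < n / Nat.lcm (ram q) (ram q') := by
    rwa [lt_div_iff₀ hL]
  have hn0 : (0 : ℚ) < n := lt_of_le_of_lt (by positivity) hn
  obtain ⟨hpos, hconj⟩ := Nat.sInf_mem (s := {n : ℕ | 0 < n ∧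
      GaloisConj (trunc ((n : ℚ) / (Nat.lcm (ram q) (ram q') : ℕ)) q)
        (trunc ((n : ℚ) / (Nat.lcm (ram q) (ram q') : ℕ)) q')}) ⟨n, mod_cast hn0, by
    rw [trunc_eq_zero ((le_max_left _ _).trans_lt hslope),
      trunc_eq_zero ((le_max_right _ _).trans_lt hslope)]
    exact GaloisConj.refl 0⟩
  exact ⟨div_pos (mod_cast hpos) hL, hconj⟩

theorem cutoff_comm : cutoff q q' = cutoff q' q := by
  have hconj (x : ℚ) : GaloisConj (trunc x q) (trunc x q') ↔ GaloisConj (trunc x q') (trunc x q) :=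
    ⟨GaloisConj.symm, GaloisConj.symm⟩
  simp only [cutoff, Nat.lcm_comm (ram q) (ram q'), hconj]

variable {q q'}

theorem cutoff_le {x : ℚ} (hx : 0 < x) (hden : x.den ∣ Nat.lcm (ram q) (ram q'))
    (h : GaloisConj (trunc x q) (trunc x q')) : cutoff q q' ≤ x := by
  have hL : (0 : ℚ) < Nat.lcm (ram q) (ram q') := mod_cast lcm_ram_pos q q'
  have hcast := numer_cast hx.le hden
  have hx' : (numer (Nat.lcm (ram q) (ram q')) x : ℚ) / Nat.lcm (ram q) (ram q') = x := by
    rw [hcast, mul_div_cancel_right₀ _ hL.ne']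
  have hpos : (0 : ℚ) < numer (Nat.lcm (ram q) (ram q')) x := hcast ▸ mul_pos hx hL
  rw [← hx'] at h
  calc cutoff q q'
      ≤ (numer (Nat.lcm (ram q) (ram q')) x : ℚ) / Nat.lcm (ram q) (ram q') :=
        div_le_div_of_nonneg_right (mod_cast Nat.sInf_le ⟨mod_cast hpos, h⟩) hL.le
    _ = x := hx'

variable (q q')

theorem diffPart_eq_filter :
    diffPart q q' = q.filter fun k : Exponent => (k : ℚ) < cutoff q q' := by
  ext k
  by_cases hk : cutoff q q' ≤ (k : ℚ)
  · simp [diffPart, commonPart, trunc, hk]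
  · simp [diffPart, commonPart, trunc, hk, not_le.1 hk]

theorem slope_diffPart_lt_cutoff : (slope (diffPart q q') : ℚ) < cutoff q q' := by
  refine slope_lt (cutoff_spec q q').1 fun k hk => ?_
  rw [diffPart_eq_filter, Finsupp.support_filter] at hk
  exact (Finset.mem_filter.1 hk).2

theorem den_slope_diffPart_dvd : (slope (diffPart q q') : ℚ).den ∣ ram q := by
  refine (den_slope_dvd_ram _).trans ?_
  rw [diffPart_eq_filter]
  exact ram_filter_dvd q _

theorem commonPart_conj : GaloisConj (commonPart q q') (commonPart q' q) := by
  rw [commonPart, commonPart, cutoff_comm q' q]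
  exact (cutoff_spec q q').2

theorem ram_commonPart_dvd_left : ram (commonPart q q') ∣ ram q := ram_filter_dvd q _

theorem ram_commonPart_dvd_right : ram (commonPart q q') ∣ ram q' :=
  ram_congr (commonPart_conj q q') ▸ ram_commonPart_dvd_left q' q

end Cutoff

section FissionExponent

/-- The fission exponent of `⟨q⟩` and `⟨q'⟩`: the larger of the slopes of their different parts.
It is the distance of the two circles for an ultrametric. -/
noncomputable def fissionExp (q q' : ExpFactor) : ℚ :=
  max (slope (diffPart q q') : ℚ) (slope (diffPart q' q) : ℚ)

variable (q q' q'' : ExpFactor)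

theorem fissionExp_comm : fissionExp q q' = fissionExp q' q := max_comm _ _

theorem fissionExp_nonneg : 0 ≤ fissionExp q q' := le_max_of_le_left (NNRat.coe_nonneg _)

theorem fissionExp_lt_cutoff : fissionExp q q' < cutoff q q' :=
  max_lt (slope_diffPart_lt_cutoff q q') (cutoff_comm q q' ▸ slope_diffPart_lt_cutoff q' q)

theorem den_fissionExp_dvd : (fissionExp q q').den ∣ Nat.lcm (ram q) (ram q') := by
  rcases max_choice (slope (diffPart q q') : ℚ) (slope (diffPart q' q) : ℚ) with h | h <;>
    rw [fissionExp, h]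
  · exact (den_slope_diffPart_dvd q q').trans (Nat.dvd_lcm_left _ _)
  · exact (den_slope_diffPart_dvd q' q).trans (Nat.dvd_lcm_right _ _)

variable {q q'} in
theorem cutoff_le_iff {k : Exponent} (hk : k ∈ q.support) :
    cutoff q q' ≤ (k : ℚ) ↔ fissionExp q q' < k := by
  refine ⟨(fissionExp_lt_cutoff q q').trans_le, fun h => ?_⟩
  by_contra! hlt
  have hmem : k ∈ (diffPart q q').support := by
    rw [diffPart_eq_filter, Finsupp.support_filter]
    exact Finset.mem_filter.2 ⟨hk, hlt⟩
  exact ((le_slope hmem).trans (le_max_left _ _)).not_gt h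

theorem commonPart_eq_filter :
    commonPart q q' = q.filter fun k : Exponent => fissionExp q q' < (k : ℚ) := by
  ext k
  by_cases hk : k ∈ q.support
  · simp [commonPart, trunc, Finsupp.filter_apply, cutoff_le_iff hk]
  · simp [commonPart, trunc, Finsupp.filter_apply, Finsupp.notMem_support_iff.1 hk]

variable {q q'} in
theorem fissionExp_le_iff {x : ℚ} (hx : 0 ≤ x) :
    fissionExp q q' ≤ x ↔
      GaloisConj (q.filter fun k : Exponent => x < (k : ℚ))
        (q'.filter fun k : Exponent => x < (k : ℚ)) := by
  constructor
  · intro h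
    have hconj := commonPart_conj q q'
    rw [commonPart_eq_filter, commonPart_eq_filter, fissionExp_comm q' q] at hconj
    exact hconj.filter_of_imp fun k hk => h.trans_lt hk
  · intro h
    by_contra! hlt
    have hconj : GaloisConj (trunc (fissionExp q q') q) (trunc (fissionExp q q') q') :=
      h.filter_of_imp fun k hk => hlt.trans_le hk
    exact (fissionExp_lt_cutoff q q').not_ge
      (cutoff_le (hx.trans_lt hlt) (den_fissionExp_dvd q q') hconj)

theorem fissionExp_le_max : fissionExp q q'' ≤ max (fissionExp q q') (fissionExp q' q'') := by
  have hnonneg : 0 ≤ max (fissionExp q q') (fissionExp q' q'') :=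
    le_max_of_le_left (fissionExp_nonneg q q')
  rw [fissionExp_le_iff hnonneg]
  exact ((fissionExp_le_iff hnonneg).1 (le_max_left _ _)).trans
    ((fissionExp_le_iff hnonneg).1 (le_max_right _ _))

end FissionExponent

section Multiplicities

theorem levelMean_support_commonPart (q q' : ExpFactor) :
    levelMean (commonPart q q').support (fissionExp q q') =
      levelMean q.support (fissionExp q q') := by
  rw [commonPart_eq_filter, Finsupp.support_filter, levelMean_filter_lt]

theorem levelMean_fissionExp_eq (q q' : ExpFactor) :
    levelMean q.support (fissionExp q q') = levelMean q'.support (fissionExp q q') := by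
  rw [← levelMean_support_commonPart, ← (commonPart_conj q q').support_eq, fissionExp_comm,
    levelMean_support_commonPart]

theorem loopMultAux_cast (q : ExpFactor) :
    (loopMultAux q : ℚ) = ram q ^ 2 * (levelMean q.support 0 - 1) + 1 := by
  have hdvd : expRam q.support ∣ ram q := dvd_rfl
  rw [loopMultAux, levelMean_of_lt fun k _ => k.2]
  push_cast
  rw [levelSum_cast hdvd hdvd]
  ring

theorem edgeFormula_cast {q q' : ExpFactor} (h : slope (diffPart q' q) ≤ slope (diffPart q q')) :
    (edgeFormula q q' : ℚ) =
      ram q * ram q' * (levelMean q.support (fissionExp q q') - 1) := by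
  have hfission : fissionExp q q' = slope (diffPart q q') := max_eq_left (NNRat.coe_le_coe.2 h)
  have hlt : ∀ k ∈ (commonPart q q').support, fissionExp q q' < (k : ℚ) := fun k hk => by
    rw [commonPart_eq_filter, Finsupp.support_filter] at hk
    exact (Finset.mem_filter.1 hk).2
  rw [← levelMean_support_commonPart, levelMean_of_lt hlt, hfission, edgeFormula]
  push_cast
  rw [levelSum_cast (ram_commonPart_dvd_left q q') (ram_commonPart_dvd_right q q'),
    gcdWith_cast (ram_commonPart_dvd_right q q'),
    numer_cast (NNRat.coe_nonneg _) (den_slope_diffPart_dvd q q')]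
  ring

theorem edgeMultAux_cast (q q' : ExpFactor) :
    (edgeMultAux q q' : ℚ) =
      ram q * ram q' * (levelMean q.support (fissionExp q q') - 1) := by
  rw [edgeMultAux]
  split_ifs with h
  · exact edgeFormula_cast h
  · rw [edgeFormula_cast (le_of_not_ge h), fissionExp_comm q' q, ← levelMean_fissionExp_eq,
      mul_comm (ram q' : ℚ)]

end Multiplicities

section RescaledDiagrams

theorem Diagram.rescaled_symm {N : Type*} (Γ : Diagram N) (r : N → ℕ+) (i j : N) :
    Γ.rescaled r i j = Γ.rescaled r j i := by
  rcases eq_or_ne i j with rfl | hij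
  · rfl
  · rw [Diagram.rescaled, Diagram.rescaled, if_neg hij, if_neg hij.symm, Γ.symm, mul_comm]

theorem ultrametricEdges_of_strictMono {N α : Type*} [LinearOrder α] {C : Matrix N N ℚ}
    (d : N → N → α) (h : N → α → ℚ) (hC_symm : ∀ i j, C i j = C j i)
    (hC : ∀ i j, i ≠ j → C i j = h i (d i j)) (hh : ∀ i, StrictMono (h i))
    (hd_symm : ∀ i j, d i j = d j i) (hd : ∀ i j k, d i k ≤ max (d i j) (d j k)) :
    UltrametricEdges C := by
  intro i j k hij hik hjk hle hle'
  have hd_le : d i j ≤ d i k := by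
    rwa [hC i j hij, hC i k hik, (hh i).le_iff_le] at hle
  have hd_le' : d k i ≤ d k j := by
    rwa [hC_symm i k, hC_symm j k, hC k i hik.symm, hC k j hjk.symm, (hh k).le_iff_le] at hle'
  have hd_ge : d k j ≤ d k i := by
    have hmax := hd k i j
    rwa [max_eq_left (hd_symm k i ▸ hd_le)] at hmax
  rw [hC_symm i k, hC_symm j k, hC k i hik.symm, hC k j hjk.symm, le_antisymm hd_le' hd_ge]

/-- The ramification order of a Stokes circle. -/
def StokesCircle.ram (I : StokesCircle) : ℕ+ :=
  Quotient.lift (fun q => ⟨NonabelianHodge.ram q, ram_pos q⟩)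
    (fun _ _ h => PNat.eq (ram_congr h)) I

theorem StokesCircle.coe_ram_mk (q : ExpFactor) :
    (StokesCircle.ram ⟦q⟧ : ℕ) = NonabelianHodge.ram q :=
  rfl

variable {N : Type*} {Γ : Diagram N} {q : N → ExpFactor}

theorem rescaled_ram_loop {i : N} (h : Γ.B i i = loopMultAux (q i)) :
    Γ.rescaled (fun i => StokesCircle.ram ⟦q i⟧) i i = levelMean (q i).support 0 - 1 := by
  have hr : (ram (q i) : ℚ) ≠ 0 := mod_cast (ram_pos (q i)).ne'
  rw [Diagram.rescaled, if_pos rfl, StokesCircle.coe_ram_mk, h, loopMultAux_cast,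
    add_sub_cancel_right, mul_div_cancel_left₀ _ (pow_ne_zero 2 hr)]

theorem rescaled_ram_edge {i j : N} (hij : i ≠ j) (h : Γ.B i j = edgeMultAux (q i) (q j)) :
    Γ.rescaled (fun i => StokesCircle.ram ⟦q i⟧) i j =
      levelMean (q i).support (fissionExp (q i) (q j)) - 1 := by
  have hi : (ram (q i) : ℚ) ≠ 0 := mod_cast (ram_pos (q i)).ne'
  have hj : (ram (q j) : ℚ) ≠ 0 := mod_cast (ram_pos (q j)).ne'
  rw [Diagram.rescaled, if_neg hij, StokesCircle.coe_ram_mk, StokesCircle.coe_ram_mk, h,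
    edgeMultAux_cast, mul_div_cancel_left₀ _ (mul_ne_zero hi hj)]

end RescaledDiagrams

end NonabelianHodge

open NonabelianHodge in
theorem corollary1p9_general {N : Type*} (Γ : Diagram N) (I : N → StokesCircle)
    (hloop : ∀ i, Γ.B i i = loopMult (I i))
    (hedge : ∀ i j, i ≠ j → Γ.B i j = edgeMult (I i) (I j)) :
    UltrametricEdges (Γ.rescaled fun i => (I i).ram) ∧
      LoopEdgeInequality (Γ.rescaled fun i => (I i).ram) := by
  obtain ⟨q, rfl⟩ : ∃ q : N → ExpFactor, (fun i => ⟦q i⟧) = I :=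
    Quotient.mk_surjective.comp_left I
  have hloop' (i : N) := rescaled_ram_loop (q := q) (hloop i)
  have hedge' (i j : N) (hij : i ≠ j) := rescaled_ram_edge (q := q) hij (hedge i j hij)
  constructor
  · exact ultrametricEdges_of_strictMono (fun i j => fissionExp (q i) (q j))
      (fun i x => levelMean (q i).support x - 1) (Γ.rescaled_symm _) hedge'
      (fun i _ _ hxy => sub_lt_sub_right (levelMean_strictMono _ hxy) 1)
      (fun i j => fissionExp_comm _ _) fun i j k => fissionExp_le_max _ _ _
  · intro i j hij
    rw [hloop' i, hedge' i j hij]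
    gcongr
    exact (levelMean_strictMono _).monotone (fissionExp_nonneg _ _)

theorem corollary1p9 {N : Type*} [Finite N] (Γ : NonabelianHodge.Diagram N)
    (hΓ : Γ.IsNonabelianHodge) :
    ∃ r : N → ℕ+,
      NonabelianHodge.UltrametricEdges (Γ.rescaled r) ∧
      NonabelianHodge.LoopEdgeInequality (Γ.rescaled r) := by
  obtain ⟨_, Θ, -, I, hloop, hedge⟩ := hΓ
  exact ⟨_, corollary1p9_general Γ (fun i => (I i).1) hloop hedge⟩
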